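/- Let $n\ge 0$ and let $$A_1\xrightarrow{\alpha_1}A_2\xrightarrow{\alpha_2}\cdots\xrightarrow{\alpha_{n-1}}A_n\xrightarrow{\alpha_n}A_{n+1}$$ be a sequence of (not necessarily unital) complex C*-algebras and $*$-homomorphisms (not necessarily unital). For $1\le k\le n$ let $$T_k=\{(a,f_2,\dots,f_{k+1})\in A_1\oplus C([0,1],A_2)\oplus\cdots\oplus C([0,1],A_{k+1}) : f_{j+1}(1)=\alpha_j\circ\cdots\circ\alpha_1(a),\ 1\le j\le k\}$$ be the cylindrical telescope of the first $k$ homomorphisms; it is a C*-algebra. Here, for a C*-algebra $A$ with unitization $A^+=\mathbb C\oplus A$, $K_0(A)$ denotes the kernel of $K_{00}(A^+)\to K_{00}(\mathbb C)$ induced by $(z,a)\mapsto z$, where $K_{00}(R)$ is the Grothendieck group of the monoid of Murray--von Neumann equivalence classes of projections in matrices over $R$. Then $K_0(A_1)\cong K_0(T_1)\cong\cdots\cong K_0(T_n)$. More precisely, for every $1\le k\le n$ the projection $T_k\to A_1$, $(a,f_2,\dots,f_{k+1})\mapsto a$, induces an isomorphism $K_0(T_k)\to K_0(A_1)$, and for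 every $1\le k<n$ the projection $T_{k+1}\to T_k$, $(a,f_2,\dots,f_{k+2})\mapsto(a,f_2,\dots,f_{k+1})$, induces an isomorphism $K_0(T_{k+1})\to K_0(T_k)$. -/

import Mathlib

noncomputable section

namespace CStarK

open Matrix

/-! ### Projections in matrix algebras and the semigroup `V(R)` -/

section Projections

/-- A projection (self-adjoint idempotent) in some matrix algebra `M_n(R)`, `n ≥ 0`. -/
structure MatProj (R : Type*) [Ring R] [StarRing R] where
  /-- the size of the matrix -/
  size : ℕ
  /-- the matrix -/
  mat : Matrix (Fin size) (Fin size) R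
  isProj : IsStarProjection mat

/-- Murray–von Neumann equivalence of square matrices of possibly different sizes:
`p = v⋆ v` and `q = v v⋆` for some rectangular matrix `v`. -/
def MvN {R : Type*} [Ring R] [StarRing R] {ι κ : Type*} [Fintype ι] [Fintype κ]
    (p : Matrix ι ι R) (q : Matrix κ κ R) : Prop :=
  ∃ v : Matrix κ ι R, vᴴ * v = p ∧ v * vᴴ = q

variable {R : Type*} [Ring R] [StarRing R]
variable {ι κ μ ν : Type*} [Fintype ι] [Fintype κ] [Fintype μ] [Fintype ν]

theorem MvN.refl {p : Matrix ι ι R} (hp : IsStarProjection p) : MvN p p := by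
  have h1 : pᴴ = p := hp.isSelfAdjoint
  have h2 : p * p = p := hp.isIdempotentElem
  exact ⟨p, by rw [h1, h2], by rw [h1, h2]⟩

theorem MvN.symm {p : Matrix ι ι R} {q : Matrix κ κ R} (h : MvN p q) : MvN q p := by
  obtain ⟨v, h1, h2⟩ := h
  exact ⟨vᴴ, by rw [conjTranspose_conjTranspose, h2], by rw [conjTranspose_conjTranspose, h1]⟩

theorem MvN.trans {p : Matrix ι ι R} {q : Matrix κ κ R} {r : Matrix μ μ R}
    (hp : IsStarProjection p) (hr : IsStarProjection r)
    (h : MvN p q) (h' : MvN q r) : MvN p r := by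
  obtain ⟨v, h1, h2⟩ := h
  obtain ⟨w, h3, h4⟩ := h'
  have hpp : p * p = p := hp.isIdempotentElem
  have hrr : r * r = r := hr.isIdempotentElem
  refine ⟨w * v, ?_, ?_⟩
  · calc (w * v)ᴴ * (w * v) = vᴴ * (wᴴ * w) * v := by
          rw [conjTranspose_mul]; simp only [Matrix.mul_assoc]
      _ = (vᴴ * v) * (vᴴ * v) := by rw [h3, ← h2]; simp only [Matrix.mul_assoc]
      _ = p := by rw [h1, hpp]
  · calc (w * v) * (w * v)ᴴ = w * (v * vᴴ) * wᴴ := by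
          rw [conjTranspose_mul]; simp only [Matrix.mul_assoc]
      _ = (w * wᴴ) * (w * wᴴ) := by rw [h2, ← h3]; simp only [Matrix.mul_assoc]
      _ = r := by rw [h4, hrr]

theorem MvN.submatrix {p : Matrix ι ι R} (hp : IsStarProjection p) (e : κ ≃ ι) :
    MvN p (p.submatrix e e) := by
  have h1 : pᴴ = p := hp.isSelfAdjoint
  have h2 : p * p = p := hp.isIdempotentElem
  refine ⟨p.submatrix e id, ?_, ?_⟩
  · rw [conjTranspose_submatrix, h1, submatrix_mul_equiv, h2, submatrix_id_id]
  · rw [conjTranspose_submatrix, h1]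
    have := submatrix_mul_equiv p p e (Equiv.refl ι) e
    rw [h2] at this
    exact this

theorem MvN.fromBlocks {p : Matrix ι ι R} {q : Matrix κ κ R} {p' : Matrix μ μ R}
    {q' : Matrix ν ν R} (h : MvN p p') (h' : MvN q q') :
    MvN (fromBlocks p 0 0 q) (fromBlocks p' 0 0 q') := by
  obtain ⟨v, h1, h2⟩ := h
  obtain ⟨w, h3, h4⟩ := h'
  refine ⟨Matrix.fromBlocks v 0 0 w, ?_, ?_⟩ <;>
    simp [fromBlocks_conjTranspose, fromBlocks_multiply, h1, h2, h3, h4]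

theorem isStarProjection_submatrix {p : Matrix ι ι R} (hp : IsStarProjection p) (e : κ ≃ ι) :
    IsStarProjection (p.submatrix e e) where
  isIdempotentElem := by
    have h2 : p * p = p := hp.isIdempotentElem
    have := submatrix_mul_equiv p p e e e
    rw [h2] at this
    exact this
  isSelfAdjoint := by
    have h1 : pᴴ = p := hp.isSelfAdjoint
    change (p.submatrix e e)ᴴ = _
    rw [conjTranspose_submatrix, h1]

theorem isStarProjection_fromBlocks {p : Matrix ι ι R} {q : Matrix κ κ R}
    (hp : IsStarProjection p) (hq : IsStarProjection q) :
    IsStarProjection (fromBlocks p 0 0 q) where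
  isIdempotentElem := by
    have h1 : p * p = p := hp.isIdempotentElem
    have h2 : q * q = q := hq.isIdempotentElem
    change Matrix.fromBlocks p 0 0 q * Matrix.fromBlocks p 0 0 q = _
    simp [fromBlocks_multiply, h1, h2]
  isSelfAdjoint := by
    have h1 : pᴴ = p := hp.isSelfAdjoint
    have h2 : qᴴ = q := hq.isSelfAdjoint
    change (Matrix.fromBlocks p 0 0 q)ᴴ = _
    simp [fromBlocks_conjTranspose, h1, h2]

namespace MatProj

/-- Murray–von Neumann equivalence on projections of all matrix sizes. -/
instance setoid (R : Type*) [Ring R] [StarRing R] : Setoid (MatProj R) where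
  r p q := MvN p.mat q.mat
  iseqv :=
    { refl := fun p => MvN.refl p.isProj
      symm := fun h => h.symm
      trans := fun {p _ r} h h' => MvN.trans p.isProj r.isProj h h' }

/-- The projection of size `0`. -/
def zero (R : Type*) [Ring R] [StarRing R] : MatProj R where
  size := 0
  mat := 0
  isProj := IsStarProjection.zero _

/-- The direct sum `diag(p, q)`. -/
def dsum (p q : MatProj R) : MatProj R where
  size := p.size + q.size
  mat := (fromBlocks p.mat 0 0 q.mat).submatrix finSumFinEquiv.symm finSumFinEquiv.symm
  isProj := isStarProjection_submatrix (isStarProjection_fromBlocks p.isProj q.isProj) _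

theorem dsum_mvN (p q : MatProj R) : MvN (fromBlocks p.mat 0 0 q.mat) (p.dsum q).mat :=
  MvN.submatrix (isStarProjection_fromBlocks p.isProj q.isProj) _

theorem equiv_of_mvN {p q : MatProj R} {P : Matrix ι ι R} {Q : Matrix κ κ R}
    (hp : MvN P p.mat) (hq : MvN Q q.mat) (hQ : IsStarProjection Q) (h : MvN P Q) : p ≈ q :=
  MvN.trans p.isProj q.isProj (MvN.trans p.isProj hQ hp.symm h) hq

/-- The entrywise image of a projection under a unital `⋆`-homomorphism. -/
def map {S : Type*} [Ring S] [StarRing S] [Algebra ℂ R] [Algebra ℂ S]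
    (f : R →⋆ₐ[ℂ] S) (p : MatProj R) : MatProj S where
  size := p.size
  mat := p.mat.map f
  isProj :=
    { isIdempotentElem := by
        have h : p.mat * p.mat = p.mat := p.isProj.isIdempotentElem
        change p.mat.map f * p.mat.map f = p.mat.map f
        rw [← Matrix.map_mul, h]
      isSelfAdjoint := by
        have h : p.matᴴ = p.mat := p.isProj.isSelfAdjoint
        change (p.mat.map f)ᴴ = p.mat.map f
        rw [← conjTranspose_map (⇑f) (fun x => map_star f x), h] }

end MatProj

/-- `V(R)`: Murray–von Neumann classes of projections in `⋃ₙ Mₙ(R)`. -/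
def V (R : Type*) [Ring R] [StarRing R] : Type _ := Quotient (MatProj.setoid R)

namespace V

/-- The class of a projection. -/
def mk (p : MatProj R) : V R := Quotient.mk _ p

instance : Zero (V R) := ⟨mk (MatProj.zero R)⟩

instance : Add (V R) :=
  ⟨Quotient.map₂ MatProj.dsum fun p p' h q q' h' =>
    MatProj.equiv_of_mvN (MatProj.dsum_mvN p q) (MatProj.dsum_mvN p' q')
      (isStarProjection_fromBlocks p'.isProj q'.isProj) (MvN.fromBlocks h h')⟩

theorem add_comm' (x y : V R) : x + y = y + x := by
  induction x using Quotient.inductionOn with | _ p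
  induction y using Quotient.inductionOn with | _ q
  refine Quotient.sound (MatProj.equiv_of_mvN (MatProj.dsum_mvN p q) (MatProj.dsum_mvN q p)
    (isStarProjection_fromBlocks q.isProj p.isProj) ?_)
  have h := MvN.submatrix (isStarProjection_fromBlocks p.isProj q.isProj)
    (Equiv.sumComm (Fin q.size) (Fin p.size))
  have e : (fromBlocks p.mat 0 0 q.mat).submatrix (Equiv.sumComm (Fin q.size) (Fin p.size))
      (Equiv.sumComm (Fin q.size) (Fin p.size)) = fromBlocks q.mat 0 0 p.mat := by
    ext (i | i) (j | j) <;> rfl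
  rwa [e] at h

theorem zero_add' (x : V R) : 0 + x = x := by
  induction x using Quotient.inductionOn with | _ p
  refine Quotient.sound (MatProj.equiv_of_mvN (MatProj.dsum_mvN (MatProj.zero R) p)
    (MvN.refl p.isProj) p.isProj (MvN.symm ?_))
  have : IsEmpty (Fin (MatProj.zero R).size) := inferInstanceAs (IsEmpty (Fin 0))
  have h := MvN.submatrix p.isProj (Equiv.emptySum (Fin (MatProj.zero R).size) (Fin p.size))
  have e : p.mat.submatrix (Equiv.emptySum (Fin (MatProj.zero R).size) (Fin p.size))
      (Equiv.emptySum (Fin (MatProj.zero R).size) (Fin p.size)) =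
      fromBlocks (MatProj.zero R).mat 0 0 p.mat := by
    ext (i | i) (j | j)
    · exact isEmptyElim i
    · exact isEmptyElim i
    · exact isEmptyElim j
    · rfl
  rwa [e] at h

theorem add_assoc' (x y z : V R) : x + y + z = x + (y + z) := by
  induction x using Quotient.inductionOn with | _ p
  induction y using Quotient.inductionOn with | _ q
  induction z using Quotient.inductionOn with | _ r
  have hl : MvN (fromBlocks (fromBlocks p.mat 0 0 q.mat) 0 0 r.mat) ((p.dsum q).dsum r).mat :=
    MvN.trans
      (isStarProjection_fromBlocks (isStarProjection_fromBlocks p.isProj q.isProj) r.isProj)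
      ((p.dsum q).dsum r).isProj
      (MvN.fromBlocks (MatProj.dsum_mvN p q) (MvN.refl r.isProj))
      (MatProj.dsum_mvN (p.dsum q) r)
  have hr : MvN (fromBlocks p.mat 0 0 (fromBlocks q.mat 0 0 r.mat)) (p.dsum (q.dsum r)).mat :=
    MvN.trans
      (isStarProjection_fromBlocks p.isProj (isStarProjection_fromBlocks q.isProj r.isProj))
      (p.dsum (q.dsum r)).isProj
      (MvN.fromBlocks (MvN.refl p.isProj) (MatProj.dsum_mvN q r))
      (MatProj.dsum_mvN p (q.dsum r))
  have hP := isStarProjection_fromBlocks (isStarProjection_fromBlocks p.isProj q.isProj) r.isProj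
  have hQ := isStarProjection_fromBlocks p.isProj (isStarProjection_fromBlocks q.isProj r.isProj)
  refine Quotient.sound (MatProj.equiv_of_mvN hl hr hQ (MvN.symm ?_))
  have h := MvN.submatrix hQ (Equiv.sumAssoc (Fin p.size) (Fin q.size) (Fin r.size))
  have e : (fromBlocks p.mat 0 0 (fromBlocks q.mat 0 0 r.mat)).submatrix
      (Equiv.sumAssoc (Fin p.size) (Fin q.size) (Fin r.size))
      (Equiv.sumAssoc (Fin p.size) (Fin q.size) (Fin r.size)) =
      fromBlocks (fromBlocks p.mat 0 0 q.mat) 0 0 r.mat := by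
    ext ((i | i) | i) ((j | j) | j) <;> rfl
  rwa [e] at h

instance : AddCommMonoid (V R) where
  add_assoc := add_assoc'
  zero_add := zero_add'
  add_zero x := by rw [add_comm', zero_add']
  add_comm := add_comm'
  nsmul := nsmulRec

variable {S : Type*} [Ring S] [StarRing S] [Algebra ℂ R] [Algebra ℂ S]

theorem mvN_map (f : R →⋆ₐ[ℂ] S) {p : Matrix ι ι R} {q : Matrix κ κ R} (h : MvN p q) :
    MvN (p.map f) (q.map f) := by
  obtain ⟨v, h1, h2⟩ := h
  have hs : (v.map f)ᴴ = vᴴ.map f :=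
    (conjTranspose_map (⇑f) (fun x => map_star f x)).symm
  exact ⟨v.map f, by rw [hs, ← Matrix.map_mul, h1], by rw [hs, ← Matrix.map_mul, h2]⟩

/-- The additive map `V(R) → V(S)` induced by a unital `⋆`-homomorphism. -/
def map (f : R →⋆ₐ[ℂ] S) : V R →+ V S where
  toFun := Quotient.map (MatProj.map f) fun _ _ h => mvN_map f h
  map_zero' := by
    refine Quotient.sound ?_
    have e : MatProj.map f (MatProj.zero R) = MatProj.zero S := by
      simp only [MatProj.map, MatProj.zero]
      congr 1
      ext i
      exact i.elim0
    rw [e]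
  map_add' x y := by
    induction x using Quotient.inductionOn with | _ p
    induction y using Quotient.inductionOn with | _ q
    refine Quotient.sound ?_
    have e : MatProj.map f (p.dsum q) = (MatProj.map f p).dsum (MatProj.map f q) := by
      simp only [MatProj.map, MatProj.dsum]
      congr 1
      rw [← Matrix.submatrix_map, Matrix.fromBlocks_map]
      congr 2 <;> ext <;> exact map_zero f
    rw [e]

end V

end Projections

/-! ### `K₀₀` of a unital `⋆`-algebra and `K₀` of a C⋆-algebra -/

/-- The Grothendieck group of `V(R)`. -/
abbrev K00 (R : Type*) [Ring R] [StarRing R] : Type _ := Algebra.GrothendieckAddGroup (V R)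

/-- The homomorphism `K₀₀(R) → K₀₀(S)` induced by a unital `⋆`-homomorphism. -/
def K00.map {R S : Type*} [Ring R] [StarRing R] [Ring S] [StarRing S] [Algebra ℂ R] [Algebra ℂ S]
    (f : R →⋆ₐ[ℂ] S) : K00 R →+ K00 S :=
  Algebra.GrothendieckAddGroup.lift (Algebra.GrothendieckAddGroup.of.comp (V.map f))

theorem V.map_comp {R S T : Type*} [Ring R] [StarRing R] [Ring S] [StarRing S] [Ring T]
    [StarRing T] [Algebra ℂ R] [Algebra ℂ S] [Algebra ℂ T] (g : S →⋆ₐ[ℂ] T) (f : R →⋆ₐ[ℂ] S) :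
    V.map (g.comp f) = (V.map g).comp (V.map f) := by
  ext x
  induction x using Quotient.inductionOn with | _ p
  rfl

theorem K00.map_of {R S : Type*} [Ring R] [StarRing R] [Ring S] [StarRing S] [Algebra ℂ R]
    [Algebra ℂ S] (f : R →⋆ₐ[ℂ] S) (x : V R) :
    K00.map f (Algebra.GrothendieckAddGroup.of x) = Algebra.GrothendieckAddGroup.of (V.map f x) :=
  DFunLike.congr_fun (Algebra.GrothendieckAddGroup.lift.symm_apply_apply
    (Algebra.GrothendieckAddGroup.of.comp (V.map f))) x

theorem K00.map_comp {R S T : Type*} [Ring R] [StarRing R] [Ring S] [StarRing S] [Ring T]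
    [StarRing T] [Algebra ℂ R] [Algebra ℂ S] [Algebra ℂ T] (g : S →⋆ₐ[ℂ] T) (f : R →⋆ₐ[ℂ] S) :
    K00.map (g.comp f) = (K00.map g).comp (K00.map f) := by
  refine Algebra.GrothendieckAddGroup.lift.symm.injective ?_
  ext x
  change K00.map (g.comp f) (Algebra.GrothendieckAddGroup.of x) =
    K00.map g (K00.map f (Algebra.GrothendieckAddGroup.of x))
  rw [K00.map_of, K00.map_of, K00.map_of, V.map_comp]
  rfl

/-- The scalar map `ε : A⁺ → ℂ`, `(z, a) ↦ z`, on the unitization `A⁺ = ℂ ⊕ A`. -/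
def scalarHom (A : Type*) [NonUnitalCStarAlgebra A] : Unitization ℂ A →⋆ₐ[ℂ] ℂ :=
  { Unitization.fstHom ℂ A with map_star' := fun _ => rfl }

theorem scalarHom_comp_starMap {A B : Type*} [NonUnitalCStarAlgebra A] [NonUnitalCStarAlgebra B]
    (f : A →⋆ₙₐ[ℂ] B) : (scalarHom B).comp (Unitization.starMap f) = scalarHom A := by
  ext x
  change (Unitization.starMap f (x : Unitization ℂ A)).fst = (x : Unitization ℂ A).fst
  rw [Unitization.starMap_inr, Unitization.fst_inr, Unitization.fst_inr]

/-- `K₀(A)` of a (not necessarily unital) C⋆-algebra `A`: the kernel of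
`K₀₀(A⁺) → K₀₀(ℂ)`. -/
def K0 (A : Type*) [NonUnitalCStarAlgebra A] : AddSubgroup (K00 (Unitization ℂ A)) :=
  (K00.map (scalarHom A)).ker

/-- The homomorphism `K₀(A) → K₀(B)` induced by a `⋆`-homomorphism `A → B`. -/
def K0.map {A B : Type*} [NonUnitalCStarAlgebra A] [NonUnitalCStarAlgebra B]
    (f : A →⋆ₙₐ[ℂ] B) : K0 A →+ K0 B :=
  ((K00.map (Unitization.starMap f)).comp (K0 A).subtype).codRestrict (K0 B) fun x => by
    change K00.map (scalarHom B) (K00.map (Unitization.starMap f) x) = 0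
    rw [← AddMonoidHom.comp_apply, ← K00.map_comp, scalarHom_comp_starMap]
    exact x.2

end CStarK

/-! ### The cylindrical telescope -/

namespace Telescope

variable {n : ℕ} (A : Fin (n + 1) → Type*) [∀ i, NonUnitalCStarAlgebra (A i)]
  (α : ∀ i : Fin n, A i.castSucc →⋆ₙₐ[ℂ] A i.succ)

/-- The composite of the first `k` homomorphisms (with `A 0` the first algebra of the sequence). -/
def comp : ∀ (k : ℕ) (hk : k < n + 1), A 0 →⋆ₙₐ[ℂ] A ⟨k, hk⟩
  | 0, _ => NonUnitalStarAlgHom.id ℂ (A 0)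
  | k + 1, hk => (α ⟨k, Nat.lt_of_succ_lt_succ hk⟩).comp (comp k (Nat.lt_of_succ_lt hk))

/-- The direct sum of the first algebra and of the algebras `C([0,1], A_j)` for the `k` algebras
`A_j` that come next in the sequence. -/
abbrev Ambient (k : ℕ) (hk : k ≤ n) : Type _ :=
  A 0 × (∀ j : Fin k, C(unitInterval, A ⟨j + 1, by omega⟩))

/-- The cylindrical telescope of the first `k` homomorphisms of the sequence: all
`(a, f)` for which each `f j` takes at `1` the value of the corresponding composite at `a`. -/
def T (k : ℕ) (hk : k ≤ n) : NonUnitalStarSubalgebra ℂ (Ambient A k hk) where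
  carrier := {x | ∀ j : Fin k, x.2 j 1 = comp A α (j + 1) (by omega) x.1}
  add_mem' := by
    intro x y hx hy j
    have h1 := hx j
    have h2 := hy j
    simp only [Prod.snd_add, Prod.fst_add, Pi.add_apply, ContinuousMap.add_apply, map_add, h1, h2]
  zero_mem' := by
    intro j
    simp
  mul_mem' := by
    intro x y hx hy j
    have h1 := hx j
    have h2 := hy j
    simp only [Prod.snd_mul, Prod.fst_mul, Pi.mul_apply, ContinuousMap.mul_apply, map_mul, h1, h2]
  smul_mem' := by
    intro c x hx j
    have h1 := hx j
    simp only [Prod.smul_snd, Prod.smul_fst, Pi.smul_apply, ContinuousMap.smul_apply, map_smul, h1]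
  star_mem' := by
    intro x hx j
    have h1 := hx j
    simp only [Prod.snd_star, Prod.fst_star, Pi.star_apply, ContinuousMap.star_apply, map_star, h1]

/-- The telescope is closed in the direct sum, hence a C⋆-algebra. -/
instance isClosed_T (k : ℕ) (hk : k ≤ n) : IsClosed (T A α k hk : Set (Ambient A k hk)) := by
  have e : (T A α k hk : Set (Ambient A k hk)) =
      ⋂ j : Fin k, {x | x.2 j 1 = comp A α (j + 1) (by omega) x.1} := by
    ext x
    simp only [Set.mem_iInter]
    rfl
  rw [e]
  refine isClosed_iInter fun j => isClosed_eq ?_ ?_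
  · exact (continuous_eval_const (1 : unitInterval)).comp
      ((continuous_apply j).comp continuous_snd)
  · have hc : Continuous (comp A α (j + 1) (by omega)) :=
      AddMonoidHomClass.continuous_of_bound _ 1 fun a => by
        simpa only [one_mul] using NonUnitalStarAlgHom.norm_apply_le _ a
    exact hc.comp continuous_fst

/-- The projection `(a, f) ↦ a` of the telescope onto the first algebra. -/
def toFirst (k : ℕ) (hk : k ≤ n) : T A α k hk →⋆ₙₐ[ℂ] A 0 where
  toFun x := x.1.1
  map_smul' _ _ := rfl
  map_zero' := rfl
  map_add' _ _ := rfl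
  map_mul' _ _ := rfl
  map_star' _ := rfl

/-- The projection of a telescope onto the previous one, dropping the last function. -/
def toPrev (k : ℕ) (hk : k + 1 ≤ n) :
    T A α (k + 1) hk →⋆ₙₐ[ℂ] T A α k (Nat.le_of_succ_le hk) where
  toFun x := ⟨(x.1.1, fun j => x.1.2 j.castSucc), fun j => x.2 j.castSucc⟩
  map_smul' _ _ := rfl
  map_zero' := rfl
  map_add' _ _ := rfl
  map_mul' _ _ := rfl
  map_star' _ := rfl

end Telescope

end

/-! Each path `f j` is pinned only at `1`, where its value is determined by `a`. Sliding every path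
towards that endpoint, by `f j (max s t)` for `t` from `0` to `1`, deforms the identity of the
telescope into `(a, f) ↦ (a, const)`, which is `ofFirst` after `toFirst`. Since `toFirst` after
`ofFirst` is the identity, homotopy invariance makes `toFirst` an isomorphism on `K₀`. The statement
for `toPrev` follows because `toFirst` factors through it.

Homotopy invariance (`K0.map_eq_of_homotopy`) needs only continuity at each element of the algebra:
a projection matrix has finitely many entries, so its image moves continuously, and nearby
projections are Murray–von Neumann equivalent (`eventually_exists_star_mul_self_eq`). The class is
thus locally constant on a connected parameter space. -/

open scoped Topology

/-! ### Equivalence of nearby projections -/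

namespace IsStarProjection

/-- In a C⋆-algebra, projections close enough to a projection `p` are Murray–von Neumann
equivalent to `p`. -/
theorem eventually_exists_star_mul_self_eq {B : Type*} [CStarAlgebra B] {p : B}
    (hp : IsStarProjection p) :
    ∀ᶠ q in 𝓝 p, IsStarProjection q → ∃ v : B, star v * v = p ∧ v * star v = q := by
  let _ := CStarAlgebra.spectralOrder B
  have _ := CStarAlgebra.spectralOrderedRing B
  have hpp : p * p = p := hp.isIdempotentElem
  have hps : star p = p := hp.isSelfAdjoint
  -- This element `z` satisfies `z * p = q * z` and equals `1` at `q = p`, so it is invertible for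
  -- `q` near `p`.
  have hcont : Continuous fun q : B => q * p + (1 - q) * (1 - p) := by fun_prop
  have hone : p * p + (1 - p) * (1 - p) = 1 := by
    simp only [mul_sub, sub_mul, mul_one, one_mul, hpp]; abel
  have hunit : ∀ᶠ q in 𝓝 p, IsUnit (q * p + (1 - q) * (1 - p)) := by
    refine hcont.continuousAt.eventually (Units.isOpen.mem_nhds ?_)
    change IsUnit (p * p + (1 - p) * (1 - p))
    rw [hone]
    exact isUnit_one
  filter_upwards [hunit] with q hz hq
  have hqq : q * q = q := hq.isIdempotentElem
  have hqs : star q = q := hq.isSelfAdjoint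
  generalize hzdef : q * p + (1 - q) * (1 - p) = z at hz
  have hzp : z * p = q * z := by
    subst hzdef
    have h1 : (1 - p) * p = 0 := by rw [sub_mul, one_mul, hpp, sub_self]
    have h2 : q * (1 - q) = 0 := by rw [mul_sub, mul_one, hqq, sub_self]
    rw [add_mul, mul_add, mul_assoc, hpp, mul_assoc, h1, mul_zero, ← mul_assoc, hqq,
      ← mul_assoc, h2, zero_mul]
  have hpz : p * star z = star z * q := by simpa [hps, hqs] using congrArg star hzp
  -- Hence the square root `s` of `star z * z` commutes with `p`, and the unitary `z * s⁻¹` of the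
  -- polar decomposition still carries `p` to `q`.
  have hcomm : Commute (star z * z) p := by
    change star z * z * p = p * (star z * z)
    rw [mul_assoc, hzp, ← mul_assoc, ← hpz, mul_assoc]
  obtain ⟨s, hss, hs, hsp⟩ : ∃ s : B, s * s = star z * z ∧ star s = s ∧ Commute s p :=
    ⟨CFC.sqrt (star z * z), CFC.sqrt_mul_sqrt_self _ (star_mul_self_nonneg z),
      (CFC.sqrt_nonneg _).isSelfAdjoint, hcomm.cfcₙ_nnreal _⟩
  have hsu : IsUnit s := by
    have h : IsUnit (s * s) := hss ▸ hz.star.mul hz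
    exact ((Commute.refl s).isUnit_mul_iff.mp h).1
  obtain ⟨s, rfl⟩ := hsu
  obtain ⟨z, rfl⟩ := hz
  have hsi : star (↑s⁻¹ : B) = ↑s⁻¹ := by
    have h : star s = s := Units.ext hs
    rw [← Units.coe_star, star_inv, h]
  have hcp : (↑s⁻¹ : B) * p = p * ↑s⁻¹ := hsp.units_inv_left
  have hzz : star z * z = s * s := Units.ext hss.symm
  have hunitary : (z : B) * (↑s⁻¹ * ↑s⁻¹) * star (z : B) = 1 := by
    have h : z * (s⁻¹ * s⁻¹) * star z = 1 := by
      rw [← mul_inv_rev, ← hzz]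
      group
    simpa using congrArg Units.val h
  -- The unitary cut down by `p` is a partial isometry from `p` to `q`.
  refine ⟨z * ↑s⁻¹ * p, ?_, ?_⟩
  · calc star ((z : B) * ↑s⁻¹ * p) * (z * ↑s⁻¹ * p)
        = p * ↑s⁻¹ * (star (z : B) * z) * ↑s⁻¹ * p := by
          simp only [star_mul, hps, hsi, mul_assoc]
      _ = p * p := by rw [← hss]; simp [mul_assoc]
      _ = p := hpp
  · calc (z : B) * ↑s⁻¹ * p * star ((z : B) * ↑s⁻¹ * p)
        = z * (↑s⁻¹ * (p * p) * ↑s⁻¹) * star (z : B) := by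
          simp only [star_mul, hps, hsi, mul_assoc]
      _ = z * p * (↑s⁻¹ * ↑s⁻¹) * star (z : B) := by rw [hpp, hcp]; simp only [mul_assoc]
      _ = q * (z * (↑s⁻¹ * ↑s⁻¹) * star (z : B)) := by rw [hzp]; simp only [mul_assoc]
      _ = q := by rw [hunitary, mul_one]

end IsStarProjection

/-! ### Homotopy invariance and functoriality of `K₀` -/

namespace CStarK

/-- Along an entrywise continuous path of projections over a C⋆-algebra, the Murray–von Neumann
class is locally constant. -/
theorem eventually_mvN {X B : Type*} [TopologicalSpace X] [CStarAlgebra B] {n : ℕ}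
    {P : X → Matrix (Fin n) (Fin n) B} (hP : ∀ x, IsStarProjection (P x)) (hc : Continuous P)
    (x : X) : ∀ᶠ y in 𝓝 x, MvN (P x) (P y) := by
  let _ := CStarAlgebra.spectralOrder B
  have _ := CStarAlgebra.spectralOrderedRing B
  have hP' : ∀ x, IsStarProjection (CStarMatrix.ofMatrix (P x)) := fun x =>
    ⟨(hP x).isIdempotentElem, (hP x).isSelfAdjoint⟩
  -- The topology of the C⋆-algebra of matrices is the entrywise one, so `hc` applies unchanged.
  have hc' : Continuous fun x => CStarMatrix.ofMatrix (P x) := hc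
  filter_upwards [hc'.continuousAt.eventually (hP' x).eventually_exists_star_mul_self_eq] with y hy
  obtain ⟨v, h1, h2⟩ := hy (hP' y)
  exact ⟨CStarMatrix.ofMatrix.symm v, h1, h2⟩

variable {A B C : Type*} [NonUnitalCStarAlgebra A] [NonUnitalCStarAlgebra B]
  [NonUnitalCStarAlgebra C]

theorem continuous_starMap_apply {X : Type*} [TopologicalSpace X] {h : X → A →⋆ₙₐ[ℂ] B}
    (hc : ∀ a, Continuous fun x => h x a) (u : Unitization ℂ A) :
    Continuous fun x => Unitization.starMap (h x) u := by
  induction u using Unitization.ind with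
  | inl_add_inr r a =>
    simp only [map_add, Unitization.starMap_inl, Unitization.starMap_inr]
    exact continuous_const.add (Unitization.continuous_inr.comp (hc a))

/-- Homotopy invariance of `V` on unitizations. -/
theorem V.map_starMap_eq_of_homotopy {X : Type*} [TopologicalSpace X] [PreconnectedSpace X]
    {h : X → A →⋆ₙₐ[ℂ] B} (hc : ∀ a, Continuous fun x => h x a) (x y : X) :
    V.map (Unitization.starMap (h x)) = V.map (Unitization.starMap (h y)) := by
  ext c
  induction c using Quotient.inductionOn with | _ p
  have hloc : IsLocallyConstant fun x =>
      (V.mk (MatProj.map (Unitization.starMap (h x)) p) : V (Unitization ℂ B)) := by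
    refine (IsLocallyConstant.iff_eventually_eq _).2 fun x => ?_
    have hcont : Continuous fun x => p.mat.map (Unitization.starMap (h x)) :=
      continuous_matrix fun i j => continuous_starMap_apply hc (p.mat i j)
    filter_upwards [eventually_mvN
      (fun x => (MatProj.map (Unitization.starMap (h x)) p).isProj) hcont x] with y hy
    exact Quotient.sound hy.symm
  exact hloc.apply_eq_of_preconnectedSpace x y

/-- Homotopy invariance of `K₀`. -/
theorem K0.map_eq_of_homotopy {X : Type*} [TopologicalSpace X] [PreconnectedSpace X]
    {h : X → A →⋆ₙₐ[ℂ] B} (hc : ∀ a, Continuous fun x => h x a) (x y : X) :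
    K0.map (h x) = K0.map (h y) := by
  ext c
  change K00.map (Unitization.starMap (h x)) c = K00.map (Unitization.starMap (h y)) c
  rw [K00.map, K00.map, V.map_starMap_eq_of_homotopy hc x y]

theorem K00.map_id {R : Type*} [Ring R] [StarRing R] [Algebra ℂ R] :
    K00.map (StarAlgHom.id ℂ R) = AddMonoidHom.id (K00 R) := by
  -- A homomorphism out of the Grothendieck group is determined on the classes coming from `V R`.
  refine Algebra.GrothendieckAddGroup.lift.symm.injective ?_
  ext x
  change K00.map (StarAlgHom.id ℂ R) (Algebra.GrothendieckAddGroup.of x) =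
    Algebra.GrothendieckAddGroup.of x
  rw [K00.map_of]
  induction x using Quotient.inductionOn with | _ p
  rfl

theorem K0.map_id : K0.map (NonUnitalStarAlgHom.id ℂ A) = AddMonoidHom.id (K0 A) := by
  ext c
  change K00.map (Unitization.starMap (NonUnitalStarAlgHom.id ℂ A)) c = c
  rw [Unitization.starMap_id, K00.map_id]
  rfl

theorem K0.map_comp (g : B →⋆ₙₐ[ℂ] C) (f : A →⋆ₙₐ[ℂ] B) :
    K0.map (g.comp f) = (K0.map g).comp (K0.map f) := by
  ext c
  change K00.map (Unitization.starMap (g.comp f)) c =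
    K00.map (Unitization.starMap g) (K00.map (Unitization.starMap f) c)
  rw [Unitization.starMap_comp, K00.map_comp]
  rfl

/-- If `g` is a section of `f` and `g ∘ f` is homotopic to the identity, then `f` induces a
bijection on `K₀`. -/
theorem K0.map_bijective_of_homotopy {f : A →⋆ₙₐ[ℂ] B} {g : B →⋆ₙₐ[ℂ] A}
    (hfg : f.comp g = NonUnitalStarAlgHom.id ℂ B) {X : Type*} [TopologicalSpace X]
    [PreconnectedSpace X] {h : X → A →⋆ₙₐ[ℂ] A} (hc : ∀ a, Continuous fun x => h x a) {x y : X}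
    (hx : h x = NonUnitalStarAlgHom.id ℂ A) (hy : h y = g.comp f) :
    Function.Bijective (K0.map f) := by
  have h1 : (K0.map g).comp (K0.map f) = AddMonoidHom.id (K0 A) := by
    rw [← K0.map_comp, ← hy, K0.map_eq_of_homotopy hc y x, hx, K0.map_id]
  have h2 : (K0.map f).comp (K0.map g) = AddMonoidHom.id (K0 B) := by
    rw [← K0.map_comp, hfg, K0.map_id]
  exact Function.bijective_iff_has_inverse.2 ⟨K0.map g, DFunLike.congr_fun h1, DFunLike.congr_fun h2⟩

/-- Two out of three; used with `g` and `g.comp f` the projections of consecutive telescopes onto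
the first algebra. -/
theorem K0.map_bijective_of_comp {f : A →⋆ₙₐ[ℂ] B} {g : B →⋆ₙₐ[ℂ] C}
    (hg : Function.Bijective (K0.map g)) (hgf : Function.Bijective (K0.map (g.comp f))) :
    Function.Bijective (K0.map f) := by
  rw [K0.map_comp, AddMonoidHom.coe_comp] at hgf
  exact (Function.Bijective.of_comp_iff' hg _).1 hgf

theorem K0.exists_addEquiv_coe_eq_map {f : A →⋆ₙₐ[ℂ] B} (hf : Function.Bijective (K0.map f)) :
    ∃ e : K0 A ≃+ K0 B, (e : K0 A →+ K0 B) = K0.map f :=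
  ⟨AddEquiv.ofBijective (K0.map f) hf, rfl⟩

end CStarK

/-! ### Contraction of the telescope onto its first algebra -/

namespace Telescope

variable {n : ℕ} (A : Fin (n + 1) → Type*) [∀ i, NonUnitalCStarAlgebra (A i)]
  (α : ∀ i : Fin n, A i.castSucc →⋆ₙₐ[ℂ] A i.succ)

/-- The section `a ↦ (a, const)` of the projection of the telescope onto the first algebra. -/
def ofFirst (k : ℕ) (hk : k ≤ n) : A 0 →⋆ₙₐ[ℂ] T A α k hk where
  toFun a := ⟨(a, fun j => .const _ (comp A α (j + 1) (by omega) a)), fun _ => rfl⟩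
  map_smul' c a := by
    refine Subtype.ext (Prod.ext rfl (funext fun j => ContinuousMap.ext fun _ => ?_))
    exact map_smul (comp A α (j + 1) (by omega)) c a
  map_zero' := by
    refine Subtype.ext (Prod.ext rfl (funext fun j => ContinuousMap.ext fun _ => ?_))
    exact map_zero (comp A α (j + 1) (by omega))
  map_add' a b := by
    refine Subtype.ext (Prod.ext rfl (funext fun j => ContinuousMap.ext fun _ => ?_))
    exact map_add (comp A α (j + 1) (by omega)) a b
  map_mul' a b := by
    refine Subtype.ext (Prod.ext rfl (funext fun j => ContinuousMap.ext fun _ => ?_))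
    exact map_mul (comp A α (j + 1) (by omega)) a b
  map_star' a := by
    refine Subtype.ext (Prod.ext rfl (funext fun j => ContinuousMap.ext fun _ => ?_))
    exact map_star (comp A α (j + 1) (by omega)) a

/-- The deformation of the telescope onto constant functions: at time `t` each `f j` is replaced by
`s ↦ f j (max s t)`. -/
def deform (k : ℕ) (hk : k ≤ n) (t : unitInterval) : T A α k hk →⋆ₙₐ[ℂ] T A α k hk where
  toFun x := ⟨(x.1.1, fun j => (x.1.2 j).comp ⟨fun s => max s t, by fun_prop⟩), fun j => by
    -- Reparametrising by `max s t` fixes the endpoint `1`, so the gluing condition survives at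
    -- every time.
    have h : max (1 : unitInterval) t = 1 := max_eq_left unitInterval.le_one'
    change x.1.2 j (max 1 t) = _
    rw [h]
    exact x.2 j⟩
  map_smul' _ _ := rfl
  map_zero' := rfl
  map_add' _ _ := rfl
  map_mul' _ _ := rfl
  map_star' _ := rfl

theorem deform_zero (k : ℕ) (hk : k ≤ n) :
    deform A α k hk 0 = NonUnitalStarAlgHom.id ℂ (T A α k hk) := by
  ext x : 1
  refine Subtype.ext (Prod.ext rfl (funext fun j => ContinuousMap.ext fun s => ?_))
  exact congrArg (x.1.2 j) (max_eq_left unitInterval.nonneg')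

theorem deform_one (k : ℕ) (hk : k ≤ n) :
    deform A α k hk 1 = (ofFirst A α k hk).comp (toFirst A α k hk) := by
  ext x : 1
  refine Subtype.ext (Prod.ext rfl (funext fun j => ContinuousMap.ext fun s => ?_))
  exact (congrArg (x.1.2 j) (max_eq_right unitInterval.le_one')).trans (x.2 j)

/-- Joint continuity of `(t, s) ↦ f j (max s t)` gives, by currying, continuity in `t` for the
topology of `C([0,1], A_j)`. -/
theorem continuous_deform_apply (k : ℕ) (hk : k ≤ n) (x : T A α k hk) :
    Continuous fun t => deform A α k hk t x := by
  refine Continuous.subtype_mk (continuous_const.prodMk (continuous_pi fun j => ?_)) _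
  refine ContinuousMap.continuous_of_continuous_uncurry _ ?_
  change Continuous fun q : unitInterval × unitInterval => x.1.2 j (max q.2 q.1)
  fun_prop

end Telescope

theorem mainTheorem8 {n : ℕ} (A : Fin (n + 1) → Type*) [∀ i, NonUnitalCStarAlgebra (A i)]
    (α : ∀ i : Fin n, A i.castSucc →⋆ₙₐ[ℂ] A i.succ) :
    (∀ (k : ℕ) (hk : k ≤ n), 1 ≤ k →
      ∃ e : CStarK.K0 (Telescope.T A α k hk) ≃+ CStarK.K0 (A 0),
        (e : CStarK.K0 (Telescope.T A α k hk) →+ CStarK.K0 (A 0)) =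
          CStarK.K0.map (Telescope.toFirst A α k hk)) ∧
    (∀ (k : ℕ) (hk : k + 1 ≤ n), 1 ≤ k →
      ∃ e : CStarK.K0 (Telescope.T A α (k + 1) hk) ≃+
          CStarK.K0 (Telescope.T A α k (Nat.le_of_succ_le hk)),
        (e : CStarK.K0 (Telescope.T A α (k + 1) hk) →+
          CStarK.K0 (Telescope.T A α k (Nat.le_of_succ_le hk))) =
          CStarK.K0.map (Telescope.toPrev A α k hk)) := by
  have h (k : ℕ) (hk : k ≤ n) : Function.Bijective (CStarK.K0.map (Telescope.toFirst A α k hk)) :=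
    CStarK.K0.map_bijective_of_homotopy (g := Telescope.ofFirst A α k hk) rfl
      (Telescope.continuous_deform_apply A α k hk) (Telescope.deform_zero A α k hk)
      (Telescope.deform_one A α k hk)
  constructor
  · intro k hk _
    exact CStarK.K0.exists_addEquiv_coe_eq_map (h k hk)
  · intro k hk _
    exact CStarK.K0.exists_addEquiv_coe_eq_map
      -- `toFirst` after `toPrev` is definitionally `toFirst` of the longer telescope.
      (CStarK.K0.map_bijective_of_comp (h k (Nat.le_of_succ_le hk)) (h (k + 1) hk))
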